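/- For an interval $I=[a,b]$, $a<b$, let $2I$ be the interval with the same centre and twice the length. For $0<\alpha<1$ and $h\ge 0$ on $\mathbb R$ put $I_\alpha h(x)=\int_{\mathbb R}|x-y|^{\alpha-1}h(y)\,dy$, and for compact $E\subset I$ put $$\mathbf{Cap}_\alpha(E;I)=\inf\Big\{\int h\,dx:\ h\ge 0,\ \operatorname{supp}h\subset 2I,\ I_\alpha h\ge |2I|^{\alpha-1}\text{ on }E\Big\}.$$ A locally finite positive Borel measure $\omega$ on $\mathbb R$ satisfies the fractional $\mathcal A_\infty^\alpha$ condition with the function $\eta:[0,1]\to[0,1]$, $\lim_{t\to 0}\eta(t)=0$, if $\omega(E)/\omega(2I)\le \eta(\mathbf{Cap}_\alpha(E;I))$ for every interval $I$ with $\omega(2I)>0$ and every compact $E\subset I$. It is doubling if $\omega\neq 0$ and there is $K$ with $\omega(2I)\le K\omega(I)$ for all intervals $I$. It is an $A_\infty$ weight if it is an $A_p$ weight for some $p>1$, i.e. $d\omega=w\,dx$ and $\sup_I\big(\frac1{|I|}\int_I w\big)\big(\frac1{|I|}\int_I w^{\frac1{1-p}}\big)^{p-1}<\infty$. **Theorem.**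 Let $0<\delta<\frac13$. There is a locally finite $1$-periodic Borel measure $\mu$ on $\mathbb R$ with $\mu([0,1])=1$ such that the middle third of every triadic interval $J\subset[0,1]$ has measure $\delta\mu(J)$ and each of the two outer thirds has measure $\frac{1-\delta}2\mu(J)$ (the triadic Garnett–Killip–Schul measure), and such that 1. $\mu$ is singular with respect to Lebesgue measure; 2. $\mu$ is doubling; 3. there is $\alpha_0\in(0,1)$ such that for all $\alpha\in(\alpha_0,1)$ the measure $\mu$ satisfies the fractional $\mathcal A_\infty^\alpha$ condition with $\eta(t)=t$; moreover, for every $\alpha$ with $1-\frac{\ln(2/(1-\delta))}{\ln 3}<\alpha<1$ there is $C<\infty$ such that $\mu$ satisfies the $\mathcal A_\infty^\alpha$ condition with $\eta(t)=\min(Ct,1)$; 4. $\mu$ is not an $A_\infty$ weight; nor are there $C,\varepsilon>0$ with $\mu(E)\le C(|E|/|I|)^{\varepsilon}\mu(I)$ for all intervals $I$ and all Borel sets $E\subset I$. -/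

import Mathlib

open MeasureTheory Set Filter Topology
open scoped ENNReal NNReal

noncomputable section

namespace FracAInf

/-- The interval `2I` for `I = [a, b]`: same centre, twice the length. -/
def dbl (a b : ℝ) : Set ℝ := Icc (a - (b - a) / 2) (b + (b - a) / 2)

/-- `ω` is a doubling measure on the line: it is not the zero measure, and
`ω (2I) ≤ K ω (I)` for all intervals `I`. -/
def IsDoubling (ω : Measure ℝ) : Prop :=
  ω ≠ 0 ∧ ∃ K : ℝ≥0, ∀ a b : ℝ, a < b → ω (dbl a b) ≤ K * ω (Icc a b)

/-- The Riesz potential `I_α h (x) = ∫ |x - y| ^ (α - 1) h(y) dy` of a nonnegative function on the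
line (for `α < 1` the kernel has the value `∞` at `y = x`). -/
def rieszPotential (α : ℝ) (h : ℝ → ℝ≥0∞) (x : ℝ) : ℝ≥0∞ :=
  ∫⁻ y, ENNReal.ofReal |x - y| ^ (α - 1) * h y

/-- The relative capacity `Cap_α (E; I)` for `I = [a, b]`: the infimum of `∫ h` over measurable
`h ≥ 0` supported in `2I` with `I_α h ≥ (diam 2I) ^ (α - 1)` on `E`. As `2I` is closed, it is the
same to ask for the set where `h ≠ 0` or for its closure to lie in `2I`. -/
def relCap (α : ℝ) (E : Set ℝ) (a b : ℝ) : ℝ≥0∞ :=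
  sInf {c | ∃ h : ℝ → ℝ≥0∞, Measurable h ∧ Function.support h ⊆ dbl a b ∧
    (∀ x ∈ E, ENNReal.ofReal (2 * (b - a)) ^ (α - 1) ≤ rieszPotential α h x) ∧
    c = ∫⁻ x, h x}

/-- `ω` satisfies the fractional `𝒜_∞^α` condition with the function `η : [0,1] → [0,1]`
(given as a function on `[0, ∞]` of which only the restriction to `[0,1]` matters). -/
def IsFracAInftyWith (α : ℝ) (η : ℝ≥0∞ → ℝ≥0∞) (ω : Measure ℝ) : Prop :=
  IsLocallyFiniteMeasure ω ∧
  MapsTo η (Icc 0 1) (Icc 0 1) ∧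
  Tendsto η (𝓝[Icc 0 1] 0) (𝓝 0) ∧
  ∀ a b : ℝ, a < b → 0 < ω (dbl a b) →
    ∀ E : Set ℝ, IsCompact E → E ⊆ Icc a b →
      ω E / ω (dbl a b) ≤ η (relCap α E a b)

/-- `ω` is an `A_p` weight: `dω = w dx` with `w ≥ 0` locally integrable and
`sup_I (⨍_I w) (⨍_I w ^ (1 / (1 - p))) ^ (p - 1) < ∞`. -/
def IsAp (p : ℝ) (ω : Measure ℝ) : Prop :=
  IsLocallyFiniteMeasure ω ∧
  ∃ w : ℝ → ℝ≥0∞, Measurable w ∧ ω = volume.withDensity w ∧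
    ∃ C : ℝ≥0, ∀ a b : ℝ, a < b →
      ((∫⁻ x in Icc a b, w x) / volume (Icc a b)) *
        ((∫⁻ x in Icc a b, w x ^ (1 / (1 - p))) / volume (Icc a b)) ^ (p - 1) ≤ C

/-- `A_∞` is the union of the classes `A_p`, `p > 1`. -/
def IsAInfty (ω : Measure ℝ) : Prop := ∃ p : ℝ, 1 < p ∧ IsAp p ω

/-- The usual other form of `A_∞`: there are `C, ε > 0` with
`ω (E) ≤ C (|E| / |I|) ^ ε ω (I)` for all intervals `I` and all Borel sets `E ⊆ I`. -/
def AInftyInequality (ω : Measure ℝ) : Prop :=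
  ∃ (C : ℝ≥0) (ε : ℝ), 0 < ε ∧ ∀ a b : ℝ, a < b → ∀ E : Set ℝ, MeasurableSet E → E ⊆ Icc a b →
    ω E ≤ C * (volume E / volume (Icc a b)) ^ ε * ω (Icc a b)

/-- The triadic interval `[k / 3 ^ m, (k + 1) / 3 ^ m]`. -/
def triadic (m : ℕ) (k : ℤ) : Set ℝ := Icc ((k : ℝ) / 3 ^ m) (((k : ℝ) + 1) / 3 ^ m)

/-- `μ` is the triadic Garnett–Killip–Schul measure with parameter `δ`, as a `1`-periodic measure
on the line: `μ [0,1] = 1`, and the middle third of a triadic interval `J ⊆ [0,1]` has measure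
`δ μ(J)`, the two outer thirds have measure `(1 - δ) / 2 * μ(J)`. -/
def IsGKS (δ : ℝ) (μ : Measure ℝ) : Prop :=
  μ (Icc 0 1) = 1 ∧
  μ.map (fun x => x + 1) = μ ∧
  ∀ (m : ℕ) (k : ℤ), 0 ≤ k → k < 3 ^ m →
    μ (triadic (m + 1) (3 * k)) = ENNReal.ofReal ((1 - δ) / 2) * μ (triadic m k) ∧
    μ (triadic (m + 1) (3 * k + 1)) = ENNReal.ofReal δ * μ (triadic m k) ∧
    μ (triadic (m + 1) (3 * k + 2)) = ENNReal.ofReal ((1 - δ) / 2) * μ (triadic m k)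

end FracAInf

end

/-!
Let `μ` be the periodization of the law of `∑ dᵢ 3⁻ⁱ`, where the digits `dᵢ` are independent and
take the values `0, 1, 2` with probabilities `(1 - δ) / 2, δ, (1 - δ) / 2`. As the outer weights
agree, adjacent triadic cells of equal length have comparable masses, and `μ` is doubling. Along
the triadic cells shrinking to a point, each step multiplies the density of `μ` by `3δ` or
`3(1 - δ) / 2`, neither of which is `1`, so the density cannot converge to a positive finite limit:
by Lebesgue's differentiation theorem `μ` is singular, hence not an `A_∞` weight.

For the capacity, put `s = ln(2 / (1 - δ)) / ln 3`. Then `μ(B(x, r)) ≲ (r / R) ^ s μ(B(x, R))` for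
`r ≤ R`, which gives `∫_I |x - y| ^ (α - 1) dμ(x) ≤ D |2I| ^ (α - 1) μ(2I)` for all `y` when
`α > 1 - s`; integrating the constraint `I_α h ≥ |2I| ^ (α - 1)` against `μ` over `E` yields
`μ(E) ≤ D Cap_α(E; I) μ(2I)`. At `α = 1` the kernel bound is `μ(I) ≤ γ μ(2I)`, where `γ < 1` by
doubling, so Hölder interpolation makes the constant at most `1` for `α` close to `1`.
-/

noncomputable section

namespace FracAInf

open Metric

lemma Icc_subset_dbl {a b : ℝ} (hab : a < b) : Icc a b ⊆ dbl a b :=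
  Icc_subset_Icc (by linarith) (by linarith)

lemma Icc_eq_closedBall (a b : ℝ) : Icc a b = closedBall ((a + b) / 2) ((b - a) / 2) := by
  rw [Real.closedBall_eq_Icc]
  congr 1 <;> ring

lemma dbl_eq_closedBall (a b : ℝ) : dbl a b = closedBall ((a + b) / 2) (2 * ((b - a) / 2)) := by
  rw [dbl, Real.closedBall_eq_Icc]
  congr 1 <;> ring

theorem isDoubling_iff_closedBall {μ : Measure ℝ} :
    IsDoubling μ ↔ μ ≠ 0 ∧
      ∃ K : ℝ≥0, ∀ x r : ℝ, 0 < r → μ (closedBall x (2 * r)) ≤ K * μ (closedBall x r) := by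
  refine and_congr_right fun _ => exists_congr fun K => ⟨fun h x r hr => ?_, fun h a b hab => ?_⟩
  · have hI := h (x - r) (x + r) (by linarith)
    rwa [dbl_eq_closedBall, ← Real.closedBall_eq_Icc, show (x - r + (x + r)) / 2 = x by ring,
      show (x + r - (x - r)) / 2 = r by ring] at hI
  · rw [dbl_eq_closedBall, Icc_eq_closedBall]
    exact h _ _ (by linarith)

/-- Polynomial decay, with exponent `s`, of the mass of small balls relative to the mass of larger
concentric ones. -/
def HasMassDecay {X : Type*} [PseudoMetricSpace X] [MeasurableSpace X] (s : ℝ) (μ : Measure X) :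
    Prop :=
  ∃ D : ℝ≥0, ∀ (x : X) (r R : ℝ), 0 < r → r ≤ R →
    μ (closedBall x r) ≤ D * ENNReal.ofReal ((r / R) ^ s) * μ (closedBall x R)

section MassDecay

variable {X : Type*} [PseudoMetricSpace X] [MeasurableSpace X] {μ : Measure X}

theorem HasMassDecay.of_geometric {c q : ℝ} (hc : 1 < c) (hq₀ : 0 < q) (hq₁ : q ≤ 1) {A : ℝ≥0}
    (h : ∀ (x : X) (R : ℝ), 0 < R → ∀ n : ℕ,
      μ (closedBall x (R / c ^ n)) ≤ A * ENNReal.ofReal (q ^ n) * μ (closedBall x R)) :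
    HasMassDecay (Real.logb c q⁻¹) μ := by
  refine ⟨A * q⁻¹.toNNReal, fun x r R hr hrR => ?_⟩
  have hR : 0 < R := hr.trans_le hrR
  obtain ⟨n, hn, hn'⟩ := exists_nat_pow_near ((one_le_div hr).2 hrR) hc
  have hc₀ : 0 < c := one_pos.trans hc
  have hs : 0 ≤ Real.logb c q⁻¹ := Real.logb_nonneg hc ((one_le_inv₀ hq₀).2 hq₁)
  have hcs : c ^ Real.logb c q⁻¹ = q⁻¹ := Real.rpow_logb hc₀ hc.ne' (inv_pos.2 hq₀)
  have hqn : q ^ n ≤ q⁻¹ * (r / R) ^ Real.logb c q⁻¹ := calc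
    q ^ n = q⁻¹ * ((c ^ (n + 1))⁻¹) ^ Real.logb c q⁻¹ := by
      rw [Real.inv_rpow (by positivity), ← Real.rpow_pow_comm hc₀.le, hcs, inv_pow, inv_inv,
        pow_succ', inv_mul_cancel_left₀ hq₀.ne']
    _ ≤ q⁻¹ * (r / R) ^ Real.logb c q⁻¹ := by
      gcongr
      rw [← inv_div]
      exact inv_anti₀ (by positivity) hn'.le
  have hball : closedBall x r ⊆ closedBall x (R / c ^ n) :=
    closedBall_subset_closedBall ((le_div_comm₀ (by positivity) hr).1 hn)
  calc μ (closedBall x r) ≤ A * ENNReal.ofReal (q ^ n) * μ (closedBall x R) :=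
        (measure_mono hball).trans (h x R hR n)
    _ ≤ A * ENNReal.ofReal (q⁻¹ * (r / R) ^ Real.logb c q⁻¹) * μ (closedBall x R) := by gcongr
    _ = (A * q⁻¹.toNNReal : ℝ≥0) * ENNReal.ofReal ((r / R) ^ Real.logb c q⁻¹) *
          μ (closedBall x R) := by
      rw [ENNReal.ofReal_mul (inv_nonneg.2 hq₀.le), ENNReal.coe_mul, ← mul_assoc]
      rfl

lemma measure_closedBall_two_pow_mul_le {K : ℝ≥0}
    (hK : ∀ (x : X) (r : ℝ), 0 < r → μ (closedBall x (2 * r)) ≤ K * μ (closedBall x r))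
    (x : X) {r : ℝ} (hr : 0 < r) (n : ℕ) :
    μ (closedBall x (2 ^ n * r)) ≤ K ^ n * μ (closedBall x r) := by
  induction n with
  | zero => simp
  | succ n ih =>
    calc μ (closedBall x (2 ^ (n + 1) * r)) = μ (closedBall x (2 * (2 ^ n * r))) := by
          rw [pow_succ', mul_assoc]
      _ ≤ K * (K ^ n * μ (closedBall x r)) := (hK x _ (by positivity)).trans (by gcongr)
      _ = K ^ (n + 1) * μ (closedBall x r) := by rw [pow_succ', mul_assoc]

end MassDecay

/-- The interval of radius `r / 4` at the right end of the doubled interval carries a fixed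
proportion of its mass and is disjoint from the interval itself. -/
theorem IsDoubling.exists_measure_closedBall_le {μ : Measure ℝ} (hμ : IsDoubling μ) :
    ∃ γ : ℝ≥0, 0 < γ ∧ γ < 1 ∧
      ∀ x r : ℝ, 0 < r → μ (closedBall x r) ≤ γ * μ (closedBall x (2 * r)) := by
  obtain ⟨-, K, hK⟩ := isDoubling_iff_closedBall.1 hμ
  set Λ : ℝ≥0 := K ^ 4 + 1
  refine ⟨Λ / (Λ + 1), by positivity, (div_lt_one (by positivity)).2 (lt_add_one Λ),
    fun x r hr => ?_⟩
  set I := closedBall x r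
  set J := closedBall (x + 7 / 4 * r) (r / 4)
  have hdisj : Disjoint I J := closedBall_disjoint_closedBall <| by
    rw [dist_self_add_right, Real.norm_of_nonneg (by positivity)]
    linarith
  have hJ : J ⊆ closedBall x (2 * r) := closedBall_subset_closedBall' <| by
    rw [dist_self_add_left, Real.norm_of_nonneg (by positivity)]
    linarith
  have hI : I ⊆ closedBall x (2 * r) := closedBall_subset_closedBall (by linarith)
  have hIJ : μ I ≤ Λ * μ J := calc
    μ I ≤ μ (closedBall (x + 7 / 4 * r) (2 ^ 4 * (r / 4))) := by
      refine measure_mono (closedBall_subset_closedBall' ?_)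
      rw [dist_self_add_right, Real.norm_of_nonneg (by positivity)]
      linarith
    _ ≤ K ^ 4 * μ J := measure_closedBall_two_pow_mul_le hK _ (by positivity) 4
    _ ≤ Λ * μ J := by
      gcongr
      exact_mod_cast le_self_add
  have hsum : (Λ + 1) * μ I ≤ Λ * μ (closedBall x (2 * r)) := calc
    (Λ + 1) * μ I ≤ Λ * μ I + Λ * μ J := by rw [add_mul, one_mul]; gcongr
    _ = Λ * μ (I ∪ J) := by rw [measure_union hdisj isClosed_closedBall.measurableSet, mul_add]
    _ ≤ Λ * μ (closedBall x (2 * r)) := by gcongr; exact union_subset hI hJ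
  rw [ENNReal.coe_div (by positivity), ENNReal.mul_comm_div, ← mul_div_assoc,
    ENNReal.le_div_iff_mul_le (by simp) (by simp), mul_comm]
  exact_mod_cast hsum

theorem IsDoubling.exists_hasMassDecay {μ : Measure ℝ} (hμ : IsDoubling μ) :
    ∃ s : ℝ, 0 < s ∧ HasMassDecay s μ := by
  obtain ⟨γ, hγ₀, hγ₁, hγ⟩ := hμ.exists_measure_closedBall_le
  refine ⟨Real.logb 2 (γ : ℝ)⁻¹, Real.logb_pos one_lt_two ((one_lt_inv₀ hγ₀).2 hγ₁),
    .of_geometric (A := 1) one_lt_two hγ₀ hγ₁.le fun x R hR n => ?_⟩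
  rw [ENNReal.coe_one, one_mul, ENNReal.ofReal_pow γ.coe_nonneg, ENNReal.ofReal_coe_nnreal]
  induction n with
  | zero => simp
  | succ n ih =>
    calc μ (closedBall x (R / 2 ^ (n + 1))) ≤ γ * μ (closedBall x (2 * (R / 2 ^ (n + 1)))) :=
          hγ x _ (by positivity)
      _ = γ * μ (closedBall x (R / 2 ^ n)) := by congr 3; field_simp; ring
      _ ≤ γ * (γ ^ n * μ (closedBall x R)) := by gcongr
      _ = γ ^ (n + 1) * μ (closedBall x R) := by rw [pow_succ', mul_assoc]

section RieszKernel

variable {X : Type*} [PseudoMetricSpace X] [MeasurableSpace X] {μ : Measure X} {y : X}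
  {M : ℝ≥0∞} {s β R : ℝ}

lemma measure_closedBall_zero_of_decay (hM : M ≠ ∞) (hs : 0 < s) (hR : 0 < R)
    (h : ∀ r, 0 < r → r ≤ R → μ (closedBall y r) ≤ M * ENNReal.ofReal ((r / R) ^ s)) :
    μ (closedBall y 0) = 0 := by
  have hlim : Tendsto (fun r : ℝ => M * ENNReal.ofReal ((r / R) ^ s)) (𝓝[>] 0) (𝓝 0) := by
    have hcont : Continuous fun r : ℝ => (r / R) ^ s :=
      (continuous_id.div_const R).rpow_const fun _ => .inr hs.le
    have := ENNReal.Tendsto.const_mul (a := M) (ENNReal.tendsto_ofReal (hcont.tendsto 0)) (.inr hM)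
    rw [zero_div, Real.zero_rpow hs.ne', ENNReal.ofReal_zero, mul_zero] at this
    exact this.mono_left nhdsWithin_le_nhds
  refine nonpos_iff_eq_zero.1 (ge_of_tendsto hlim ?_)
  filter_upwards [Ioc_mem_nhdsGT hR] with r hr
  exact (measure_mono (closedBall_subset_closedBall hr.1.le)).trans (h r hr.1 hr.2)

lemma setLIntegral_Ioi_rpow_neg {a T : ℝ} (ha : 1 < a) (hT : 0 < T) :
    ∫⁻ t in Ioi T, ENNReal.ofReal (t ^ (-a)) = ENNReal.ofReal (T ^ (1 - a) / (a - 1)) := by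
  rw [← ofReal_integral_eq_lintegral_ofReal (integrableOn_Ioi_rpow_of_lt (by linarith) hT),
    integral_Ioi_rpow_of_lt (by linarith) hT]
  · rw [neg_div, ← div_neg]
    ring_nf
  · filter_upwards [ae_restrict_mem measurableSet_Ioi] with t ht
    exact Real.rpow_nonneg (hT.trans ht).le _

lemma measure_lt_dist_rpow_neg_le (hβ : 0 < β) (hR : 0 < R)
    (h : ∀ r, 0 < r → r ≤ R → μ (closedBall y r) ≤ M * ENNReal.ofReal ((r / R) ^ s))
    {t : ℝ} (ht : R ^ (-β) < t) :
    μ {x | t < dist x y ^ (-β)} ≤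
      M * (ENNReal.ofReal ((R ^ (-β)) ^ (s / β)) * ENNReal.ofReal (t ^ (-(s / β)))) := by
  have hT : 0 < R ^ (-β) := Real.rpow_pos_of_pos hR _
  have ht₀ : 0 < t := hT.trans ht
  have hsub : {x | t < dist x y ^ (-β)} ⊆ closedBall y (t ^ (-β⁻¹)) := by
    intro x (hx : t < dist x y ^ (-β))
    calc dist x y = (dist x y ^ (-β)) ^ (-β⁻¹) := by
          rw [← Real.rpow_mul dist_nonneg, neg_mul_neg, mul_inv_cancel₀ hβ.ne', Real.rpow_one]
      _ ≤ t ^ (-β⁻¹) :=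
          Real.rpow_le_rpow_of_nonpos ht₀ hx.le (neg_nonpos.2 (inv_nonneg.2 hβ.le))
  have hle : t ^ (-β⁻¹) ≤ R := calc
    t ^ (-β⁻¹) ≤ (R ^ (-β)) ^ (-β⁻¹) :=
      Real.rpow_le_rpow_of_nonpos hT ht.le (neg_nonpos.2 (inv_nonneg.2 hβ.le))
    _ = R := by rw [← Real.rpow_mul hR.le, neg_mul_neg, mul_inv_cancel₀ hβ.ne', Real.rpow_one]
  refine (measure_mono hsub).trans ((h _ (by positivity) hle).trans_eq ?_)
  rw [Real.div_rpow (by positivity) hR.le, ← ENNReal.ofReal_mul (by positivity),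
    ← Real.rpow_mul ht₀.le, ← Real.rpow_mul hR.le, div_eq_inv_mul, ← Real.rpow_neg hR.le]
  congr 4 <;> field_simp

lemma setLIntegral_measure_lt_dist_rpow_neg_le (hβ : 0 < β) (hβs : β < s) (hR : 0 < R)
    (hM : M ≠ ∞)
    (h : ∀ r, 0 < r → r ≤ R → μ (closedBall y r) ≤ M * ENNReal.ofReal ((r / R) ^ s)) :
    ∫⁻ t in Ioi (R ^ (-β)), μ {x | t < dist x y ^ (-β)} ≤
      M * ENNReal.ofReal (R ^ (-β) * (β / (s - β))) := by
  set T := R ^ (-β)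
  have hT : 0 < T := Real.rpow_pos_of_pos hR _
  calc ∫⁻ t in Ioi T, μ {x | t < dist x y ^ (-β)}
      ≤ ∫⁻ t in Ioi T, M * (ENNReal.ofReal (T ^ (s / β)) * ENNReal.ofReal (t ^ (-(s / β)))) :=
        setLIntegral_mono' measurableSet_Ioi fun t ht => measure_lt_dist_rpow_neg_le hβ hR h ht
    _ = M * ENNReal.ofReal (T * (β / (s - β))) := by
        rw [lintegral_const_mul' _ _ hM, lintegral_const_mul' _ _ ENNReal.ofReal_ne_top,
          setLIntegral_Ioi_rpow_neg ((one_lt_div hβ).2 hβs) hT,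
          ← ENNReal.ofReal_mul (by positivity), ← mul_div_assoc, ← Real.rpow_add hT,
          add_sub_cancel, Real.rpow_one]
        congr 2
        field_simp

/-- Layer cake: the kernel exceeds `t > R ^ (-β)` only on the ball of radius `t ^ (-1 / β)`. -/
theorem lintegral_dist_rpow_neg_le [OpensMeasurableSpace X] (hβ : 0 < β) (hβs : β < s) (hR : 0 < R)
    (huniv : μ univ ≤ M)
    (h : ∀ r, 0 < r → r ≤ R → μ (closedBall y r) ≤ M * ENNReal.ofReal ((r / R) ^ s)) :
    ∫⁻ x, ENNReal.ofReal (dist x y) ^ (-β) ∂μ ≤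
      ENNReal.ofReal (s / (s - β)) * M * ENNReal.ofReal R ^ (-β) := by
  have hsβ : 0 < s - β := sub_pos.2 hβs
  have hs : 0 < s := hβ.trans hβs
  set T := R ^ (-β) with hT_def
  have hT : 0 < T := Real.rpow_pos_of_pos hR _
  rw [ENNReal.ofReal_rpow_of_pos hR, ← hT_def]
  rcases eq_or_ne M ∞ with rfl | hM
  · rw [ENNReal.mul_top (by simpa using div_pos hs hsβ), ENNReal.top_mul (by simpa using hT)]
    exact le_top
  have hnull : ∀ᵐ x ∂μ, 0 < dist x y := by
    rw [ae_iff]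
    simpa only [closedBall, not_lt] using measure_closedBall_zero_of_decay hM hs hR h
  have hmeas : Measurable fun x => dist x y ^ (-β) :=
    (continuous_id.dist continuous_const).measurable.pow_const _
  calc ∫⁻ x, ENNReal.ofReal (dist x y) ^ (-β) ∂μ
      = ∫⁻ x, ENNReal.ofReal (dist x y ^ (-β)) ∂μ := by
        refine lintegral_congr_ae ?_
        filter_upwards [hnull] with x hx using ENNReal.ofReal_rpow_of_pos hx
    _ = ∫⁻ t in Ioi (0 : ℝ), μ {x | t < dist x y ^ (-β)} :=
        lintegral_eq_lintegral_meas_lt μ (.of_forall fun x => by positivity) hmeas.aemeasurable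
    _ ≤ (∫⁻ t in Ioc 0 T, μ {x | t < dist x y ^ (-β)}) +
          ∫⁻ t in Ioi T, μ {x | t < dist x y ^ (-β)} := by
        rw [← Ioc_union_Ioi_eq_Ioi hT.le]
        exact lintegral_union_le _ _ _
    _ ≤ M * ENNReal.ofReal T + M * ENNReal.ofReal (T * (β / (s - β))) := by
        gcongr
        · calc ∫⁻ t in Ioc 0 T, μ {x | t < dist x y ^ (-β)} ≤ ∫⁻ _ in Ioc 0 T, M :=
                lintegral_mono fun t => (measure_mono (subset_univ _)).trans huniv
            _ = M * ENNReal.ofReal T := by rw [setLIntegral_const, Real.volume_Ioc, sub_zero]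
        · exact setLIntegral_measure_lt_dist_rpow_neg_le hβ hβs hR hM h
    _ = ENNReal.ofReal (s / (s - β)) * M * ENNReal.ofReal T := by
        rw [← mul_add, ← ENNReal.ofReal_add hT.le (by positivity), mul_right_comm,
          ← ENNReal.ofReal_mul (by positivity), mul_comm M]
        congr 2
        field_simp
        ring

theorem HasMassDecay.nullSingletonClass {μ : Measure X} [IsLocallyFiniteMeasure μ]
    (hμ : HasMassDecay s μ) (hs : 0 < s) : NullSingletonClass μ := by
  obtain ⟨D, hD⟩ := hμ
  refine ⟨fun x => ?_⟩
  obtain ⟨R, hR, hfin⟩ := (μ.finiteAt_nhds x).exists_mem_basis nhds_basis_closedBall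
  have hdecay := measure_closedBall_zero_of_decay (M := D * μ (closedBall x R))
    (ENNReal.mul_ne_top ENNReal.coe_ne_top hfin.ne) hs hR fun r hr hrR => by
      rw [mul_right_comm]
      exact hD x r R hr hrR
  exact measure_mono_null (singleton_subset_iff.2 (mem_closedBall_self le_rfl)) hdecay

end RieszKernel

/-- The kernel of the Riesz potential of order `α` has integrals over `I` controlled by
`|2I| ^ (α - 1) μ(2I)`, uniformly in the pole. By duality this bounds `μ` by the relative
capacity. -/
def RieszBound (α : ℝ) (D : ℝ≥0) (μ : Measure ℝ) : Prop :=
  ∀ a b : ℝ, a < b → ∀ y : ℝ, ∫⁻ x in Icc a b, ENNReal.ofReal |x - y| ^ (α - 1) ∂μ ≤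
    D * ENNReal.ofReal (2 * (b - a)) ^ (α - 1) * μ (dbl a b)

/-- Replacing the pole `y` by the nearest point of `I` only increases the kernel on `I`. -/
lemma ofReal_abs_sub_rpow_le_projIcc {a b x β : ℝ} (hab : a ≤ b) (hβ : 0 ≤ β) (hx : x ∈ Icc a b)
    (y : ℝ) :
    ENNReal.ofReal |x - y| ^ (-β) ≤ ENNReal.ofReal (dist x (projIcc a b hab y)) ^ (-β) := by
  have hdist : dist x (projIcc a b hab y) ≤ |x - y| := by
    simpa only [projIcc_of_mem hab hx, Real.dist_eq] using
      abs_projIcc_sub_projIcc hab (c := x) (d := y)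
  rw [ENNReal.rpow_neg, ENNReal.rpow_neg]
  gcongr

lemma ofReal_div_two_rpow_neg (x β : ℝ) :
    ENNReal.ofReal (x / 2) ^ (-β) = 4 ^ β * ENNReal.ofReal (2 * x) ^ (-β) := by
  rw [show x / 2 = 2 * x / 4 by ring, ENNReal.ofReal_div_of_pos (by norm_num),
    ENNReal.ofReal_ofNat, div_eq_mul_inv,
    ENNReal.mul_rpow_of_ne_top ENNReal.ofReal_ne_top (by simp),
    ENNReal.rpow_neg 4⁻¹, ENNReal.inv_rpow, inv_inv, mul_comm]

theorem HasMassDecay.exists_rieszBound {μ : Measure ℝ} {s α : ℝ} (hμ : HasMassDecay s μ)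
    (hα : 1 - s < α) (hα₁ : α < 1) : ∃ D : ℝ≥0, 0 < D ∧ RieszBound α D μ := by
  obtain ⟨D, hD⟩ := hμ
  obtain ⟨β, rfl⟩ : ∃ β, α = 1 - β := ⟨1 - α, by ring⟩
  have hβ : 0 < β := by linarith
  have hβs : β < s := by linarith
  have hs : 0 < s / (s - β) := div_pos (hβ.trans hβs) (sub_pos.2 hβs)
  refine ⟨(s / (s - β)).toNNReal * (D + 1) * 4 ^ β, by positivity, fun a b hab y => ?_⟩
  rw [sub_sub_cancel_left]
  set z : ℝ := (projIcc a b hab.le y : ℝ)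
  have hz : z ∈ Icc a b := (projIcc a b hab.le y).2
  set R := (b - a) / 2 with hR_def
  have hR : 0 < R := by linarith
  set M : ℝ≥0∞ := (D + 1) * μ (dbl a b)
  have hball : closedBall z R ⊆ dbl a b := by
    rw [Real.closedBall_eq_Icc]
    exact Icc_subset_Icc (by linarith [hz.1]) (by linarith [hz.2])
  have hmass : μ.restrict (Icc a b) univ ≤ M := by
    rw [Measure.restrict_apply_univ]
    exact (measure_mono (Icc_subset_dbl hab)).trans (le_mul_of_one_le_left' le_add_self)
  have hdecay : ∀ r, 0 < r → r ≤ R →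
      μ.restrict (Icc a b) (closedBall z r) ≤ M * ENNReal.ofReal ((r / R) ^ s) := by
    intro r hr hrR
    rw [mul_right_comm]
    refine (Measure.restrict_apply_le _ _).trans ((hD z r R hr hrR).trans ?_)
    gcongr
    exact le_self_add
  calc ∫⁻ x in Icc a b, ENNReal.ofReal |x - y| ^ (-β) ∂μ
      ≤ ∫⁻ x in Icc a b, ENNReal.ofReal (dist x z) ^ (-β) ∂μ :=
        setLIntegral_mono' measurableSet_Icc fun x hx =>
          ofReal_abs_sub_rpow_le_projIcc hab.le hβ.le hx y
    _ ≤ ENNReal.ofReal (s / (s - β)) * M * ENNReal.ofReal R ^ (-β) :=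
        lintegral_dist_rpow_neg_le hβ hβs hR hmass hdecay
    _ = ((s / (s - β)).toNNReal * (D + 1) * 4 ^ β : ℝ≥0) * ENNReal.ofReal (2 * (b - a)) ^ (-β) *
          μ (dbl a b) := by
        rw [hR_def, ofReal_div_two_rpow_neg, ENNReal.coe_mul, ENNReal.coe_mul, ENNReal.coe_add,
          ENNReal.coe_rpow_of_nonneg _ hβ.le]
        simp only [M, ENNReal.ofReal, ENNReal.coe_ofNat, ENNReal.coe_one]
        ring

namespace RieszBound

variable {μ : Measure ℝ} {α : ℝ} {D : ℝ≥0}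

lemma mono {D' : ℝ≥0} (h : RieszBound α D μ) (hD : D ≤ D') : RieszBound α D' μ :=
  fun a b hab y => (h a b hab y).trans (by gcongr)

/-- Tonelli: integrate the constraint on an admissible `h` against `μ` over `E`, and move the
kernel onto `μ`. -/
lemma measure_le_mul_lintegral [SFinite μ] (hμ : RieszBound α D μ) {a b : ℝ} (hab : a < b)
    {E : Set ℝ} (hE : MeasurableSet E) (hEI : E ⊆ Icc a b) {h : ℝ → ℝ≥0∞} (hh : Measurable h)
    (hle : ∀ x ∈ E, ENNReal.ofReal (2 * (b - a)) ^ (α - 1) ≤ rieszPotential α h x) :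
    μ E ≤ D * (∫⁻ x, h x) * μ (dbl a b) := by
  have hlen : 0 < ENNReal.ofReal (2 * (b - a)) := ENNReal.ofReal_pos.2 (by linarith)
  set c := ENNReal.ofReal (2 * (b - a)) ^ (α - 1)
  have hc₀ : c ≠ 0 := (ENNReal.rpow_pos hlen ENNReal.ofReal_ne_top).ne'
  have hc : c ≠ ∞ := ENNReal.rpow_ne_top_of_ne_zero hlen.ne' ENNReal.ofReal_ne_top
  rw [← ENNReal.mul_le_mul_iff_right hc₀ hc]
  calc c * μ E = ∫⁻ _ in E, c ∂μ := (setLIntegral_const E c).symm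
    _ ≤ ∫⁻ x in E, (∫⁻ y, ENNReal.ofReal |x - y| ^ (α - 1) * h y) ∂μ := setLIntegral_mono' hE hle
    _ = ∫⁻ y, ∫⁻ x in E, ENNReal.ofReal |x - y| ^ (α - 1) * h y ∂μ := by
        refine lintegral_lintegral_swap (Measurable.aemeasurable ?_)
        simp only [Function.uncurry_def]
        fun_prop
    _ = ∫⁻ y, (∫⁻ x in E, ENNReal.ofReal |x - y| ^ (α - 1) ∂μ) * h y :=
        lintegral_congr fun y => lintegral_mul_const _ (by fun_prop)
    _ ≤ ∫⁻ y, D * c * μ (dbl a b) * h y := by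
        gcongr with y
        exact (lintegral_mono_set hEI).trans (hμ a b hab y)
    _ = c * (D * (∫⁻ x, h x) * μ (dbl a b)) := by
        rw [lintegral_const_mul _ hh]
        ring

theorem measure_div_le_mul_relCap [SFinite μ] (hμ : RieszBound α D μ) (hD : 0 < D) {a b : ℝ}
    (hab : a < b) {E : Set ℝ} (hE : MeasurableSet E) (hEI : E ⊆ Icc a b) :
    μ E / μ (dbl a b) ≤ D * relCap α E a b := by
  have hD₀ : (D : ℝ≥0∞) ≠ 0 := ENNReal.coe_ne_zero.2 hD.ne'
  rw [← ENNReal.div_le_iff' hD₀ ENNReal.coe_ne_top]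
  refine le_sInf ?_
  rintro _ ⟨h, hh, -, hle, rfl⟩
  rw [ENNReal.div_le_iff' hD₀ ENNReal.coe_ne_top]
  exact ENNReal.div_le_of_le_mul (hμ.measure_le_mul_lintegral hab hE hEI hh hle)

theorem isFracAInftyWith_min [IsLocallyFiniteMeasure μ] (hμ : RieszBound α D μ) (hD : 0 < D) :
    IsFracAInftyWith α (fun t => min (D * t) 1) μ := by
  refine ⟨inferInstance, fun t _ => ⟨zero_le, min_le_right _ _⟩, ?_, fun a b hab _ E hE hEI => ?_⟩
  · have hcont : Continuous fun t : ℝ≥0∞ => min ((D : ℝ≥0∞) * t) 1 :=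
      (ENNReal.continuous_const_mul ENNReal.coe_ne_top).min continuous_const
    simpa using (hcont.tendsto 0).mono_left (nhdsWithin_le_nhds (s := Icc 0 1))
  · refine le_min (hμ.measure_div_le_mul_relCap hD hab hE.measurableSet hEI) ?_
    exact ENNReal.div_le_of_le_mul <|
      (measure_mono (hEI.trans (Icc_subset_dbl hab))).trans_eq (one_mul _).symm

theorem isFracAInftyWith_id [IsLocallyFiniteMeasure μ] (hμ : RieszBound α 1 μ) :
    IsFracAInftyWith α (fun t => t) μ := by
  refine ⟨inferInstance, fun t ht => ht, tendsto_id.mono_left nhdsWithin_le_nhds,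
    fun a b hab _ E hE hEI => ?_⟩
  simpa only [ENNReal.coe_one, one_mul] using
    hμ.measure_div_le_mul_relCap one_pos hab hE.measurableSet hEI

theorem interpolate (hμ : RieszBound α D μ) {γ : ℝ≥0}
    (hγ : ∀ a b : ℝ, a < b → μ (Icc a b) ≤ γ * μ (dbl a b)) {θ : ℝ} (hθ₀ : 0 ≤ θ) (hθ₁ : θ ≤ 1) :
    RieszBound (1 - θ * (1 - α)) (D ^ θ * γ ^ (1 - θ)) μ := by
  intro a b hab y
  have hθ : 0 ≤ 1 - θ := sub_nonneg.2 hθ₁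
  have hexp : 1 - θ * (1 - α) - 1 = (α - 1) * θ := by ring
  set c := ENNReal.ofReal (2 * (b - a))
  rw [hexp, ENNReal.coe_mul, ENNReal.coe_rpow_of_nonneg _ hθ₀, ENNReal.coe_rpow_of_nonneg _ hθ]
  calc ∫⁻ x in Icc a b, ENNReal.ofReal |x - y| ^ ((α - 1) * θ) ∂μ
      = ∫⁻ x in Icc a b, (ENNReal.ofReal |x - y| ^ (α - 1)) ^ θ * 1 ^ (1 - θ) ∂μ := by
        simp only [ENNReal.rpow_mul, ENNReal.one_rpow, mul_one]
    _ ≤ (∫⁻ x in Icc a b, ENNReal.ofReal |x - y| ^ (α - 1) ∂μ) ^ θ *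
          (∫⁻ _ in Icc a b, 1 ∂μ) ^ (1 - θ) :=
        ENNReal.lintegral_mul_norm_pow_le (by fun_prop) aemeasurable_const hθ₀ hθ
          (add_sub_cancel θ 1)
    _ ≤ (D * c ^ (α - 1) * μ (dbl a b)) ^ θ * (γ * μ (dbl a b)) ^ (1 - θ) := by
        rw [setLIntegral_one]
        gcongr
        · exact hμ a b hab y
        · exact hγ a b hab
    _ = D ^ θ * γ ^ (1 - θ) * c ^ ((α - 1) * θ) * (μ (dbl a b) ^ θ * μ (dbl a b) ^ (1 - θ)) := by
        simp only [ENNReal.mul_rpow_of_nonneg _ _ hθ₀, ENNReal.mul_rpow_of_nonneg _ _ hθ,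
          ENNReal.rpow_mul]
        ring
    _ = D ^ θ * γ ^ (1 - θ) * c ^ ((α - 1) * θ) * μ (dbl a b) := by
        rw [← ENNReal.rpow_add_of_nonneg _ _ hθ₀ hθ, add_sub_cancel, ENNReal.rpow_one]

end RieszBound

lemma eventually_rpow_mul_rpow_one_sub_le_one {D γ : ℝ≥0} (hD : 0 < D) (hγ₀ : 0 < γ)
    (hγ₁ : γ < 1) : ∀ᶠ θ : ℝ in 𝓝 0, D ^ θ * γ ^ (1 - θ) ≤ 1 := by
  have hcont : Continuous fun θ : ℝ => D ^ θ * γ ^ (1 - θ) := by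
    have hreal : Continuous fun θ : ℝ => (D : ℝ) ^ θ * (γ : ℝ) ^ (1 - θ) :=
      (Real.continuous_const_rpow (NNReal.coe_ne_zero.2 hD.ne')).mul
        ((Real.continuous_const_rpow (NNReal.coe_ne_zero.2 hγ₀.ne')).comp (continuous_sub_left 1))
    exact continuous_induced_rng.2 hreal
  have hlim := hcont.tendsto 0
  rw [NNReal.rpow_zero, sub_zero, NNReal.rpow_one, one_mul] at hlim
  exact hlim.eventually_le_const hγ₁

/-- Hölder interpolation between a Riesz bound of some order and the trivial bound of order one,
whose constant is less than one by reverse doubling. -/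
theorem IsDoubling.eventually_isFracAInftyWith_id {μ : Measure ℝ} [IsLocallyFiniteMeasure μ]
    (hμ : IsDoubling μ) : ∀ᶠ α in 𝓝[<] 1, IsFracAInftyWith α (fun t => t) μ := by
  obtain ⟨γ, hγ₀, hγ₁, hγ⟩ := hμ.exists_measure_closedBall_le
  have hγI : ∀ a b : ℝ, a < b → μ (Icc a b) ≤ γ * μ (dbl a b) := fun a b hab => by
    rw [Icc_eq_closedBall, dbl_eq_closedBall]
    exact hγ _ _ (by linarith)
  obtain ⟨s, hs, hdecay⟩ := hμ.exists_hasMassDecay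
  obtain ⟨α₁, hα₁s, hα₁⟩ := exists_between (show 1 - s < 1 by linarith)
  obtain ⟨D, hD, hbound⟩ := hdecay.exists_rieszBound hα₁s hα₁
  have hβ : 0 < 1 - α₁ := sub_pos.2 hα₁
  have hlim : Tendsto (fun α : ℝ => (1 - α) / (1 - α₁)) (𝓝[<] 1) (𝓝 0) := by
    have hcont : Continuous fun α : ℝ => (1 - α) / (1 - α₁) := by fun_prop
    simpa using (hcont.tendsto 1).mono_left nhdsWithin_le_nhds
  filter_upwards [hlim.eventually (eventually_rpow_mul_rpow_one_sub_le_one hD hγ₀ hγ₁),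
    hlim.eventually_le_const one_pos, self_mem_nhdsWithin] with α hconst hθ₁ (hα : α < 1)
  have hθ₀ : 0 ≤ (1 - α) / (1 - α₁) := div_nonneg (by linarith) hβ.le
  have hα_eq : 1 - (1 - α) / (1 - α₁) * (1 - α₁) = α := by
    rw [div_mul_cancel₀ _ hβ.ne', sub_sub_cancel]
  have hRiesz := (hbound.interpolate hγI hθ₀ hθ₁).mono hconst
  rw [hα_eq] at hRiesz
  exact hRiesz.isFracAInftyWith_id

/-- The half-open interval `[k bᵐ, (k + 1) bᵐ)` of the `b`-adic grid, at any scale `m : ℤ`. -/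
def cell (b : ℕ) (m k : ℤ) : Set ℝ := Ico (k * (b : ℝ) ^ m) ((k + 1) * (b : ℝ) ^ m)

/-- The `b`-adic cell of length `bᵐ` containing `x`. -/
def cellAt (b : ℕ) (m : ℤ) (x : ℝ) : Set ℝ := cell b m ⌊x / (b : ℝ) ^ m⌋

section Cells

variable {b : ℕ} {m k : ℤ} {x : ℝ}

lemma measurableSet_cell : MeasurableSet (cell b m k) := measurableSet_Ico

lemma closedBall_subset_cells {r : ℝ} (hx : x ∈ cell b m k) (hr : r ≤ (b : ℝ) ^ m) :
    closedBall x r ⊆ cell b m (k - 1) ∪ cell b m k ∪ cell b m (k + 1) := by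
  rw [Real.closedBall_eq_Icc]
  rintro y ⟨hy, hy'⟩
  simp only [cell, mem_union, mem_Ico] at hx ⊢
  push_cast
  rcases lt_or_ge y (k * (b : ℝ) ^ m) with h | h
  · exact .inl (.inl ⟨by linarith, by linarith⟩)
  rcases lt_or_ge y ((k + 1) * (b : ℝ) ^ m) with h' | h'
  · exact .inl (.inr ⟨h, h'⟩)
  · exact .inr ⟨h', by linarith⟩

variable [NeZero b]

lemma mem_cell_iff_floor : x ∈ cell b m k ↔ ⌊x / (b : ℝ) ^ m⌋ = k := by
  have hb : 0 < (b : ℝ) ^ m := zpow_pos (by exact_mod_cast NeZero.pos b) m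
  rw [Int.floor_eq_iff, le_div_iff₀ hb, div_lt_iff₀ hb]
  rfl

lemma mem_cellAt : x ∈ cellAt b m x := mem_cell_iff_floor.2 rfl

lemma floor_div_zpow_succ (b : ℕ) [NeZero b] (m : ℤ) (x : ℝ) :
    ⌊x / (b : ℝ) ^ (m + 1)⌋ = ⌊x / (b : ℝ) ^ m⌋ / b := by
  rw [← Int.floor_div_natCast, div_div, zpow_add_one₀ (NeZero.ne _)]

lemma exists_eq_mul_add_fin (b : ℕ) [NeZero b] (k : ℤ) :
    ∃ j : Fin b, k = b * (k / b) + (j : ℕ) := by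
  have hb : (0 : ℤ) < b := by exact_mod_cast NeZero.pos b
  have hnonneg := Int.emod_nonneg k hb.ne'
  refine ⟨⟨(k % b).toNat, by have := Int.emod_lt_of_pos k hb; omega⟩, ?_⟩
  rw [Int.toNat_of_nonneg hnonneg, Int.mul_ediv_add_emod]

lemma mul_add_fin_ediv (k : ℤ) (j : Fin b) : (b * k + (j : ℕ)) / b = k := by
  have hb : (b : ℤ) ≠ 0 := by exact_mod_cast NeZero.ne b
  rw [Int.add_comm, Int.add_mul_ediv_left _ _ hb, Int.ediv_eq_zero_of_lt (by simp) (by simp),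
    zero_add]

lemma exists_cellAt_eq (b : ℕ) [NeZero b] (m : ℤ) (x : ℝ) : ∃ (k : ℤ) (j : Fin b),
    cellAt b (m + 1) x = cell b (m + 1) k ∧ cellAt b m x = cell b m (b * k + (j : ℕ)) := by
  obtain ⟨j, hj⟩ := exists_eq_mul_add_fin b ⌊x / (b : ℝ) ^ m⌋
  refine ⟨⌊x / (b : ℝ) ^ (m + 1)⌋, j, rfl, ?_⟩
  rw [floor_div_zpow_succ, ← hj, cellAt]

lemma iUnion_cell_mul_add_fin (m k : ℤ) :
    ⋃ j : Fin b, cell b m (b * k + (j : ℕ)) = cell b (m + 1) k := by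
  ext x
  simp only [mem_iUnion, mem_cell_iff_floor, floor_div_zpow_succ]
  refine ⟨fun ⟨j, hj⟩ => by rw [hj, mul_add_fin_ediv], fun h => ?_⟩
  obtain ⟨j, hj⟩ := exists_eq_mul_add_fin b ⌊x / (b : ℝ) ^ m⌋
  exact ⟨j, h ▸ hj⟩

lemma measure_cell_succ (μ : Measure ℝ) (m k : ℤ) :
    μ (cell b (m + 1) k) = ∑ j : Fin b, μ (cell b m (b * k + (j : ℕ))) := by
  rw [← iUnion_cell_mul_add_fin, measure_iUnion _ fun j => measurableSet_cell, tsum_fintype]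
  intro i j hij
  refine Set.disjoint_left.2 fun x hi hj => hij (Fin.ext ?_)
  have := (mem_cell_iff_floor.1 hi).symm.trans (mem_cell_iff_floor.1 hj)
  omega

lemma cellAt_subset_closedBall {r : ℝ} (hr : (b : ℝ) ^ m ≤ r) : cellAt b m x ⊆ closedBall x r := by
  intro y hy
  have hx : x ∈ cellAt b m x := mem_cellAt
  rw [mem_closedBall, Real.dist_eq, abs_le]
  simp only [cellAt, cell, mem_Ico] at hx hy
  constructor <;> linarith

lemma measure_cellAt_le_pow {μ : Measure ℝ} {q : ℝ≥0∞}
    (hq : ∀ (m k : ℤ) (j : Fin b), μ (cell b m (b * k + (j : ℕ))) ≤ q * μ (cell b (m + 1) k))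
    (x : ℝ) (m : ℤ) (n : ℕ) : μ (cellAt b m x) ≤ q ^ n * μ (cellAt b (m + n) x) := by
  induction n with
  | zero => simp
  | succ n ih =>
    obtain ⟨k, j, hparent, hchild⟩ := exists_cellAt_eq b (m + n) x
    rw [Nat.cast_succ, ← add_assoc, pow_succ, mul_assoc, hparent]
    rw [hchild] at ih
    exact ih.trans (by gcongr; exact hq _ k j)

end Cells

/-- Regularity of a measure on the `b`-adic grid: adjacent cells of equal length, and each cell and
its parent, have comparable masses, with constant `K`. -/
structure IsGridDoubling (b : ℕ) (K : ℝ≥0) (μ : Measure ℝ) : Prop where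
  right_le : ∀ m k : ℤ, μ (cell b m (k + 1)) ≤ K * μ (cell b m k)
  left_le : ∀ m k : ℤ, μ (cell b m k) ≤ K * μ (cell b m (k + 1))
  parent_le : ∀ (m k : ℤ) (j : Fin b),
    μ (cell b (m + 1) k) ≤ K * μ (cell b m (b * k + (j : ℕ)))

namespace IsGridDoubling

variable {b : ℕ} [NeZero b] {K : ℝ≥0} {μ : Measure ℝ} {m : ℤ}

lemma measure_cellAt_succ_le (hμ : IsGridDoubling b K μ) (m : ℤ) (x : ℝ) :
    μ (cellAt b (m + 1) x) ≤ K * μ (cellAt b m x) := by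
  obtain ⟨k, j, hparent, hchild⟩ := exists_cellAt_eq b m x
  rw [hparent, hchild]
  exact hμ.parent_le m k j

lemma measure_closedBall_le (hμ : IsGridDoubling b K μ) (x : ℝ) {r : ℝ} (hr : r ≤ (b : ℝ) ^ m) :
    μ (closedBall x r) ≤ (2 * K + 1) * μ (cellAt b m x) := by
  set k := ⌊x / (b : ℝ) ^ m⌋
  have hleft := hμ.left_le m (k - 1)
  rw [sub_add_cancel] at hleft
  calc μ (closedBall x r)
      ≤ μ (cell b m (k - 1) ∪ cell b m k ∪ cell b m (k + 1)) :=
        measure_mono (closedBall_subset_cells mem_cellAt hr)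
    _ ≤ μ (cell b m (k - 1)) + μ (cell b m k) + μ (cell b m (k + 1)) :=
        (measure_union_le _ _).trans (by gcongr; exact measure_union_le _ _)
    _ ≤ K * μ (cell b m k) + μ (cell b m k) + K * μ (cell b m k) := by
        gcongr
        exact hμ.right_le m k
    _ = (2 * K + 1) * μ (cellAt b m x) := by
        rw [cellAt]
        ring

theorem isLocallyFiniteMeasure (hμ : IsGridDoubling b K μ) (hfin : ∀ k : ℤ, μ (cell b m k) ≠ ∞) :
    IsLocallyFiniteMeasure μ := by
  refine ⟨fun x => ⟨closedBall x ((b : ℝ) ^ m), closedBall_mem_nhds x ?_, ?_⟩⟩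
  · exact zpow_pos (by exact_mod_cast NeZero.pos b) m
  · exact (hμ.measure_closedBall_le x le_rfl).trans_lt
      (ENNReal.mul_lt_top (by finiteness) (hfin _).lt_top)

theorem isDoubling (hμ : IsGridDoubling b K μ) (hb : 1 < b) (hμ₀ : μ ≠ 0) : IsDoubling μ := by
  have hb₂ : (2 : ℝ) ≤ b := by exact_mod_cast hb
  refine isDoubling_iff_closedBall.2 ⟨hμ₀, (2 * K + 1) * K ^ 2, fun x r hr => ?_⟩
  obtain ⟨m, hm, hm'⟩ := exists_mem_Ico_zpow hr (show (1 : ℝ) < b by exact_mod_cast hb)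
  have hscale : 2 * r ≤ (b : ℝ) ^ (m + 1 + 1) := by
    rw [zpow_add_one₀ (by positivity), mul_comm]
    gcongr
  calc μ (closedBall x (2 * r)) ≤ (2 * K + 1) * μ (cellAt b (m + 1 + 1) x) :=
        hμ.measure_closedBall_le x hscale
    _ ≤ (2 * K + 1) * (K * (K * μ (cellAt b m x))) := by
        gcongr
        exact (hμ.measure_cellAt_succ_le _ x).trans (by gcongr; exact hμ.measure_cellAt_succ_le m x)
    _ ≤ (2 * K + 1) * (K * (K * μ (closedBall x r))) := by
        gcongr
        exact cellAt_subset_closedBall hm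
    _ = ((2 * K + 1) * K ^ 2 : ℝ≥0) * μ (closedBall x r) := by
        push_cast
        ring

theorem hasMassDecay (hμ : IsGridDoubling b K μ) (hb : 1 < b) {q : ℝ} (hq₀ : 0 < q) (hq₁ : q ≤ 1)
    (hq : ∀ (m k : ℤ) (j : Fin b),
      μ (cell b m (b * k + (j : ℕ))) ≤ ENNReal.ofReal q * μ (cell b (m + 1) k)) :
    HasMassDecay (Real.logb b q⁻¹) μ := by
  have hb₁ : (1 : ℝ) < b := by exact_mod_cast hb
  have hb₀ : (0 : ℝ) < b := one_pos.trans hb₁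
  refine .of_geometric (A := (2 * K + 1) * K) hb₁ hq₀ hq₁ fun x R hR n => ?_
  obtain ⟨m, hm, hm'⟩ := exists_mem_Ico_zpow hR hb₁
  have hscale : R / (b : ℝ) ^ n ≤ (b : ℝ) ^ (m + 1 - n) := by
    rw [zpow_sub₀ hb₀.ne', zpow_natCast]
    gcongr
  calc μ (closedBall x (R / (b : ℝ) ^ n))
      ≤ (2 * K + 1) * μ (cellAt b (m + 1 - n) x) := hμ.measure_closedBall_le x hscale
    _ ≤ (2 * K + 1) * (ENNReal.ofReal q ^ n * μ (cellAt b (m + 1) x)) := by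
        gcongr
        simpa only [sub_add_cancel] using measure_cellAt_le_pow hq x (m + 1 - n) n
    _ ≤ (2 * K + 1) * (ENNReal.ofReal q ^ n * (K * μ (closedBall x R))) := by
        gcongr
        exact (hμ.measure_cellAt_succ_le m x).trans (by gcongr; exact cellAt_subset_closedBall hm)
    _ = ((2 * K + 1) * K : ℝ≥0) * ENNReal.ofReal (q ^ n) * μ (closedBall x R) := by
        rw [ENNReal.ofReal_pow hq₀.le]
        push_cast
        ring

end IsGridDoubling

/-- The `1`-periodic multinomial measure with weights `p`: unit intervals have mass one, and the
`j`-th of the `b` children of a cell of length at most one has the proportion `p j` of its mass. -/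
structure IsMultinomial (b : ℕ) (p : Fin b → ℝ≥0∞) (μ : Measure ℝ) : Prop where
  periodic : μ.map (fun x => x + 1) = μ
  unit : ∀ k : ℤ, μ (cell b 0 k) = 1
  child : ∀ (n : ℕ) (k : ℤ) (j : Fin b),
    μ (cell b (-(n + 1)) (b * k + (j : ℕ))) = p j * μ (cell b (-n) k)

namespace IsMultinomial

variable {b : ℕ} {p : Fin b → ℝ≥0∞} {μ : Measure ℝ}

lemma ne_zero (hμ : IsMultinomial b p μ) : μ ≠ 0 := by
  rintro rfl
  simpa using hμ.unit 0

variable [NeZero b]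

lemma sum_weights (hμ : IsMultinomial b p μ) : ∑ j, p j = 1 := by
  have hcell := measure_cell_succ (b := b) μ (-1) 0
  have hchild := fun j => hμ.child 0 0 j
  simp only [Nat.cast_zero, zero_add, neg_zero, hμ.unit, mul_one] at hchild
  rwa [neg_add_cancel, hμ.unit, Finset.sum_congr rfl fun j _ => hchild j, eq_comm] at hcell

lemma weight_le_one (hμ : IsMultinomial b p μ) (j : Fin b) : p j ≤ 1 :=
  hμ.sum_weights ▸ Finset.single_le_sum (fun _ _ => zero_le) (Finset.mem_univ j)

lemma measure_cell_natCast (hμ : IsMultinomial b p μ) (n : ℕ) (k : ℤ) :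
    μ (cell b n k) = (b : ℝ≥0∞) ^ n := by
  induction n generalizing k with
  | zero => simpa using hμ.unit k
  | succ n ih =>
    rw [Nat.cast_succ, measure_cell_succ, Finset.sum_congr rfl fun j _ => ih _]
    simp [pow_succ']

lemma child_le (hμ : IsMultinomial b p μ) {q : ℝ≥0∞} (hq : ∀ j, p j ≤ q) (m k : ℤ) (j : Fin b) :
    μ (cell b m (b * k + (j : ℕ))) ≤ q * μ (cell b (m + 1) k) := by
  rcases m with n | n
  · have hbq : 1 ≤ b * q := by
      simpa [hμ.sum_weights] using Finset.sum_le_sum fun j (_ : j ∈ Finset.univ) => hq j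
    rw [Int.ofNat_eq_natCast, ← Nat.cast_succ, hμ.measure_cell_natCast, hμ.measure_cell_natCast,
      pow_succ', ← mul_assoc, mul_comm q]
    exact le_mul_of_one_le_left' hbq
  · rw [Int.negSucc_eq, hμ.child, neg_add, neg_add_cancel_right]
    gcongr
    exact hq j

variable {K : ℝ≥0}

lemma natCast_le_of_one_le_mul (hμ : IsMultinomial b p μ) (hK : ∀ j, 1 ≤ K * p j) :
    (b : ℝ≥0∞) ≤ K := by
  simpa [← Finset.mul_sum, hμ.sum_weights] using
    Finset.sum_le_sum fun j (_ : j ∈ Finset.univ) => hK j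

lemma one_le_of_one_le_mul (hμ : IsMultinomial b p μ) (hK : ∀ j, 1 ≤ K * p j) : (1 : ℝ≥0∞) ≤ K :=
  (Nat.one_le_cast.2 NeZero.one_le).trans (hμ.natCast_le_of_one_le_mul hK)

lemma parent_le (hμ : IsMultinomial b p μ) (hK : ∀ j, 1 ≤ K * p j) (m k : ℤ) (j : Fin b) :
    μ (cell b (m + 1) k) ≤ K * μ (cell b m (b * k + (j : ℕ))) := by
  rcases m with n | n
  · rw [Int.ofNat_eq_natCast, ← Nat.cast_succ, hμ.measure_cell_natCast, hμ.measure_cell_natCast,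
      pow_succ']
    gcongr
    exact hμ.natCast_le_of_one_le_mul hK
  · rw [Int.negSucc_eq, hμ.child, neg_add, neg_add_cancel_right, ← mul_assoc]
    exact le_mul_of_one_le_left' (hK j)

/-- Two adjacent cells are siblings, or the last child of a cell and the first child of the next
one; in the second case the equality of the extreme weights transfers the comparison from their
parents with no loss in the constant. -/
lemma adjacent_le (hμ : IsMultinomial b p μ) (hK : ∀ j, 1 ≤ K * p j)
    (hends : p 0 = p (Fin.rev 0)) (n : ℕ) (k : ℤ) :
    μ (cell b (-n) (k + 1)) ≤ K * μ (cell b (-n) k) ∧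
      μ (cell b (-n) k) ≤ K * μ (cell b (-n) (k + 1)) := by
  induction n generalizing k with
  | zero =>
    simp only [Nat.cast_zero, neg_zero, hμ.unit, mul_one, and_self]
    exact hμ.one_le_of_one_le_mul hK
  | succ n ih =>
    obtain ⟨j, hj⟩ := exists_eq_mul_add_fin b k
    set l := k / b
    have hsibling : ∀ i i' : Fin b,
        p i * μ (cell b (-n) l) ≤ K * (p i' * μ (cell b (-n) l)) := fun i i' => by
      rw [← mul_assoc]
      exact mul_le_mul_left ((hμ.weight_le_one i).trans (hK i')) _
    rw [Nat.cast_succ]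
    rcases Nat.lt_or_ge (j + 1) b with hlt | hge
    · have hk : k + 1 = b * l + ((⟨j + 1, hlt⟩ : Fin b) : ℕ) := by
        rw [hj]
        push_cast
        ring
      rw [hk, hj, hμ.child, hμ.child]
      exact ⟨hsibling _ _, hsibling _ _⟩
    · have hk : k + 1 = b * (l + 1) + ((0 : Fin b) : ℕ) := by
        have hjb : ((j : ℕ) : ℤ) + 1 = b := by omega
        rw [hj, Fin.coe_ofNat_eq_mod, Nat.zero_mod, Nat.cast_zero, add_zero, add_assoc, hjb,
          mul_add, mul_one]
      have hlast : j = Fin.rev 0 := by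
        ext
        rw [Fin.val_rev, Fin.coe_ofNat_eq_mod, Nat.zero_mod]
        omega
      rw [hk, hj, hμ.child, hμ.child, hlast, ← hends, mul_left_comm, mul_left_comm (K : ℝ≥0∞)]
      exact ⟨by gcongr; exact (ih l).1, by gcongr; exact (ih l).2⟩

theorem isGridDoubling (hμ : IsMultinomial b p μ) (hK : ∀ j, 1 ≤ K * p j)
    (hends : p 0 = p (Fin.rev 0)) : IsGridDoubling b K μ := by
  have hadj : ∀ m k : ℤ, μ (cell b m (k + 1)) ≤ K * μ (cell b m k) ∧
      μ (cell b m k) ≤ K * μ (cell b m (k + 1)) := by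
    intro m k
    rcases m with n | n
    · rw [Int.ofNat_eq_natCast, hμ.measure_cell_natCast, hμ.measure_cell_natCast, and_self]
      exact le_mul_of_one_le_left' (hμ.one_le_of_one_le_mul hK)
    · exact hμ.adjacent_le hK hends (n + 1) k
  exact ⟨fun m k => (hadj m k).1, fun m k => (hadj m k).2, hμ.parent_le hK⟩

end IsMultinomial

section Density

variable {b : ℕ}

lemma cell_ae_eq_closedBall {μ : Measure ℝ} [NullSingletonClass μ] (m k : ℤ) :
    cell b m k =ᵐ[μ] closedBall ((k + 1 / 2) * (b : ℝ) ^ m) ((b : ℝ) ^ m / 2) := by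
  have hleft : (k + 1 / 2) * (b : ℝ) ^ m - (b : ℝ) ^ m / 2 = k * (b : ℝ) ^ m := by ring
  have hright : (k + 1 / 2) * (b : ℝ) ^ m + (b : ℝ) ^ m / 2 = (k + 1) * (b : ℝ) ^ m := by ring
  rw [cell, Real.closedBall_eq_Icc, hleft, hright]
  exact Ico_ae_eq_Icc

lemma volume_cell (m k : ℤ) : volume (cell b m k) = ENNReal.ofReal ((b : ℝ) ^ m) := by
  rw [cell, Real.volume_Ico]
  ring_nf

lemma volume_cell_succ [NeZero b] (m k l : ℤ) :
    volume (cell b (m + 1) k) = b * volume (cell b m l) := by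
  rw [volume_cell, volume_cell, zpow_add_one₀ (NeZero.ne _), mul_comm,
    ENNReal.ofReal_mul (by positivity), ENNReal.ofReal_natCast]

lemma ae_tendsto_measure_cellAt_div_volume (hb : 1 < b) (μ : Measure ℝ) [IsLocallyFiniteMeasure μ]
    [NullSingletonClass μ] :
    ∀ᵐ x, Tendsto (fun n : ℕ => μ (cellAt b (-n) x) / volume (cellAt b (-n) x)) atTop
      (𝓝 (μ.rnDeriv volume x)) := by
  have : NeZero b := ⟨by lia⟩
  have hb' : (1 : ℝ) < b := by exact_mod_cast hb
  have hradius : Tendsto (fun n : ℕ => (b : ℝ) ^ (-n : ℤ) / 2) atTop (𝓝[>] 0) := by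
    refine tendsto_nhdsWithin_iff.2 ⟨?_, Eventually.of_forall fun n => mem_Ioi.2 (by positivity)⟩
    simpa [inv_pow] using (tendsto_pow_atTop_nhds_zero_of_lt_one (by positivity)
      (inv_lt_one_of_one_lt₀ hb')).div_const 2
  filter_upwards [VitaliFamily.ae_tendsto_rnDeriv
    (IsUnifLocDoublingMeasure.vitaliFamily (volume : Measure ℝ) 1) μ] with x hx
  have hball := hx.comp (IsUnifLocDoublingMeasure.tendsto_closedBall_filterAt (volume : Measure ℝ)
    (K := 1) (fun n : ℕ => (⌊x / (b : ℝ) ^ (-n : ℤ)⌋ + 1 / 2) * (b : ℝ) ^ (-n : ℤ)) _ hradius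
    (Eventually.of_forall fun n => by
      have hmem : x ∈ cellAt b (-n) x := mem_cellAt
      simp only [cellAt, cell, mem_Ico] at hmem
      rw [one_mul, Real.closedBall_eq_Icc]
      constructor <;> linarith))
  refine hball.congr fun n => ?_
  rw [Function.comp_apply, cellAt, measure_congr (cell_ae_eq_closedBall _ _),
    measure_congr (cell_ae_eq_closedBall _ _)]

end Density

namespace IsMultinomial

variable {b : ℕ} {p : Fin b → ℝ≥0∞} {μ : Measure ℝ}

lemma exists_measure_cellAt_succ_div_volume [NeZero b] (hμ : IsMultinomial b p μ) (x : ℝ) (n : ℕ) :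
    ∃ j, μ (cellAt b (-(n + 1 : ℕ)) x) / volume (cellAt b (-(n + 1 : ℕ)) x) =
      b * p j * (μ (cellAt b (-n) x) / volume (cellAt b (-n) x)) := by
  obtain ⟨k, j, hparent, hchild⟩ := exists_cellAt_eq b (-(n + 1)) x
  have hvolume := volume_cell_succ (b := b) (-(n + 1)) k (b * k + (j : ℕ))
  rw [show -((n : ℤ) + 1) + 1 = -n by ring] at hparent hvolume
  refine ⟨j, ?_⟩
  rw [Nat.cast_succ, hchild, hparent, hμ.child, hvolume, ← mul_div_assoc, mul_assoc,
    ENNReal.mul_div_mul_left _ _ (NeZero.ne _) (ENNReal.natCast_ne_top b)]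

lemma mutuallySingular [IsLocallyFiniteMeasure μ] [NullSingletonClass μ] (hμ : IsMultinomial b p μ)
    (hb : 1 < b) (hp : ∀ j, p j ≠ (b : ℝ≥0∞)⁻¹) : μ ⟂ₘ volume := by
  have : NeZero b := ⟨by lia⟩
  rw [← Measure.rnDeriv_eq_zero]
  filter_upwards [ae_tendsto_measure_cellAt_div_volume hb μ, Measure.rnDeriv_lt_top μ volume]
    with x hx hfin
  by_contra hpos
  set u : ℕ → ℝ≥0∞ := fun n => μ (cellAt b (-n) x) / volume (cellAt b (-n) x)
  have hratio : Tendsto (fun n => u (n + 1) / u n) atTop (𝓝 1) := by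
    simpa only [ENNReal.div_self hpos hfin.ne, Function.comp_def] using
      ENNReal.Tendsto.div (hx.comp (tendsto_add_atTop_nat 1)) (.inl hpos) hx (.inl hfin.ne)
  have hfactor : ∀ j, (1 : ℝ≥0∞) ≠ b * p j := fun j h =>
    hp j (ENNReal.eq_inv_of_mul_eq_one_left (by rw [mul_comm, ← h]))
  have hu_pos : ∀ᶠ n in atTop, u n ≠ 0 := hx.eventually_ne hpos
  have hu_fin : ∀ᶠ n in atTop, u n ≠ ∞ := hx.eventually_ne hfin.ne
  have havoid : ∀ᶠ n in atTop, ∀ j, u (n + 1) / u n ≠ b * p j :=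
    eventually_all.2 fun j => hratio.eventually_ne (hfactor j)
  obtain ⟨n, hn_pos, hn_fin, hn⟩ := (hu_pos.and (hu_fin.and havoid)).exists
  obtain ⟨j, hj⟩ := hμ.exists_measure_cellAt_succ_div_volume x n
  exact hn j (by rw [show u (n + 1) = _ from hj, ENNReal.mul_div_cancel_right hn_pos hn_fin])

end IsMultinomial

section Shift

variable {X : Type*}

/-- The sequence with first term `x` followed by the terms of `d`. -/
def consSeq (x : X) (d : ℕ → X) : ℕ → X
  | 0 => x
  | n + 1 => d n

lemma consSeq_preimage_pi (t : ℕ → Set X) (n : ℕ) :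
    Function.uncurry consSeq ⁻¹' (Finset.range (n + 1) : Set ℕ).pi t =
      t 0 ×ˢ (Finset.range n : Set ℕ).pi fun i => t (i + 1) := by
  ext ⟨x, d⟩
  simp only [mem_preimage, Function.uncurry_apply_pair, mem_prod, Set.mem_pi, Finset.mem_coe,
    Finset.mem_range]
  refine ⟨fun h => ⟨h 0 n.succ_pos, fun i hi => h (i + 1) (by lia)⟩, fun h i hi => ?_⟩
  cases i with
  | zero => exact h.1
  | succ i => exact h.2 i (by lia)

variable [MeasurableSpace X]

lemma measurable_uncurry_consSeq : Measurable (Function.uncurry (consSeq (X := X))) := by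
  refine measurable_pi_lambda _ fun n => ?_
  cases n with
  | zero => exact measurable_fst
  | succ n => exact (measurable_pi_apply n).comp measurable_snd

lemma eq_infinitePi_of_range {P : Measure X} [IsProbabilityMeasure P] {ν : Measure (ℕ → X)}
    (hν : ∀ (n : ℕ) (t : ℕ → Set X), (∀ i, MeasurableSet (t i)) →
      ν ((Finset.range (n + 1) : Set ℕ).pi t) = ∏ i ∈ Finset.range (n + 1), P (t i)) :
    ν = Measure.infinitePi fun _ => P := by
  refine Measure.eq_infinitePi _ fun s t ht => ?_
  classical
  set t' : ℕ → Set X := fun i => if i ∈ s then t i else univ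
  have hs : s ⊆ Finset.range (s.sup id + 1) := fun i hi =>
    Finset.mem_range.2 (Nat.lt_succ_of_le (Finset.le_sup (f := id) hi))
  have hpi : (s : Set ℕ).pi t = (Finset.range (s.sup id + 1) : Set ℕ).pi t' := by
    ext d
    simp only [Set.mem_pi, Finset.mem_coe, t']
    refine ⟨fun h i _ => ?_, fun h i hi => by simpa only [if_pos hi] using h i (hs hi)⟩
    split_ifs with hi
    exacts [h i hi, trivial]
  rw [hpi, hν _ _ fun i => by simp only [t']; split_ifs <;> simp [ht],
    ← Finset.prod_subset hs fun i _ hi => by simp only [t', if_neg hi, measure_univ]]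
  exact Finset.prod_congr rfl fun i hi => by simp only [t', if_pos hi]

lemma map_consSeq_prod_infinitePi (P : Measure X) [IsProbabilityMeasure P] :
    (P.prod (Measure.infinitePi fun _ => P)).map (Function.uncurry consSeq) =
      Measure.infinitePi fun _ : ℕ => P := by
  refine eq_infinitePi_of_range fun n t ht => ?_
  rw [Measure.map_apply measurable_uncurry_consSeq
      (MeasurableSet.pi (Finset.countable_toSet _) fun i _ => ht i), consSeq_preimage_pi,
    Measure.prod_prod, Measure.infinitePi_pi _ fun i _ => ht _, Finset.prod_range_succ', mul_comm]

lemma infinitePi_apply_eq_sum [Fintype X] [MeasurableSingletonClass X] (P : Measure X)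
    [IsProbabilityMeasure P] {A : Set (ℕ → X)} (hA : MeasurableSet A) :
    Measure.infinitePi (fun _ => P) A =
      ∑ x, P {x} * Measure.infinitePi (fun _ => P) (consSeq x ⁻¹' A) := by
  conv_lhs => rw [← map_consSeq_prod_infinitePi P, Measure.map_apply measurable_uncurry_consSeq hA,
    Measure.prod_apply (measurable_uncurry_consSeq hA), lintegral_fintype]
  exact Finset.sum_congr rfl fun x _ => mul_comm _ _

end Shift

lemma ofDigits_consSeq {b : ℕ} (j : Fin b) (d : ℕ → Fin b) :
    Real.ofDigits (consSeq j d) = (Real.ofDigits d + (j : ℕ)) / b := by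
  rw [Real.ofDigits_eq_sum_add_ofDigits _ 1]
  simp only [Finset.range_one, Finset.sum_singleton, Real.ofDigitsTerm, consSeq, zero_add, pow_one]
  ring

/-- A probability measure on `[0, 1]` that is self-similar with weights `p` under the maps
`x ↦ (x + j) / b`. -/
structure IsSelfSimilar (b : ℕ) (p : Fin b → ℝ≥0∞) (ν : Measure ℝ) : Prop where
  isProbabilityMeasure : IsProbabilityMeasure ν
  compl_Icc : ν (Icc 0 1)ᶜ = 0
  apply_eq_sum : ∀ A, MeasurableSet A →
    ν A = ∑ j : Fin b, p j * ν ((fun x : ℝ => (x + (j : ℕ)) / b) ⁻¹' A)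

theorem exists_isSelfSimilar {b : ℕ} (p : Fin b → ℝ≥0∞) (hp : ∑ j, p j = 1) :
    ∃ ν, IsSelfSimilar b p ν := by
  set P : Measure (Fin b) := (PMF.ofFintype p hp).toMeasure
  have hP (j : Fin b) : P {j} = p j :=
    PMF.toMeasure_apply_singleton _ _ (measurableSet_singleton j)
  have hmeas : Measurable (Real.ofDigits (b := b)) := Real.continuous_ofDigits.measurable
  refine ⟨(Measure.infinitePi fun _ => P).map Real.ofDigits,
    Measure.isProbabilityMeasure_map hmeas.aemeasurable, ?_, fun A hA => ?_⟩
  · have hrange : Real.ofDigits (b := b) ⁻¹' (Icc 0 1)ᶜ = ∅ :=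
      eq_empty_of_forall_notMem fun d hd => hd ⟨Real.ofDigits_nonneg d, Real.ofDigits_le_one d⟩
    rw [Measure.map_apply hmeas measurableSet_Icc.compl, hrange, measure_empty]
  · rw [Measure.map_apply hmeas hA, infinitePi_apply_eq_sum P (hmeas hA)]
    refine Finset.sum_congr rfl fun j _ => ?_
    have hshift : Measurable fun x : ℝ => (x + (j : ℕ)) / b := by fun_prop
    rw [hP, Measure.map_apply hmeas (hshift hA)]
    simp only [preimage, ofDigits_consSeq, mem_ofPred_eq]

section Preimages

variable {b : ℕ} [NeZero b]

lemma preimage_add_cell (n : ℕ) (k l : ℤ) :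
    (fun x : ℝ => x + l) ⁻¹' cell b (-n) k = cell b (-n) (k - l * b ^ n) := by
  ext x
  have hfloor : (x + l) / (b : ℝ) ^ (-n : ℤ) = x / (b : ℝ) ^ (-n : ℤ) + (l * b ^ n : ℤ) := by
    push_cast
    rw [add_div, zpow_neg, zpow_natCast, div_inv_eq_mul, div_inv_eq_mul]
  rw [mem_preimage, mem_cell_iff_floor, mem_cell_iff_floor, hfloor, Int.floor_add_intCast,
    eq_sub_iff_add_eq]

lemma preimage_div_cell (m k : ℤ) : (fun x : ℝ => x / b) ⁻¹' cell b m k = cell b (m + 1) k := by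
  ext x
  rw [mem_preimage, mem_cell_iff_floor, mem_cell_iff_floor, div_div, zpow_add_one₀ (NeZero.ne _),
    mul_comm]

lemma preimage_add_div_cell (n : ℕ) (k : ℤ) (j : ℕ) :
    (fun x : ℝ => (x + j) / b) ⁻¹' cell b (-(n + 1)) k = cell b (-n) (k - j * b ^ n) := by
  have hcomp := preimage_add_cell (b := b) n k j
  rw [← hcomp, show (-n : ℤ) = -(n + 1) + 1 by ring, ← preimage_div_cell]
  rfl

end Preimages

namespace IsSelfSimilar

variable {b : ℕ} [NeZero b] {p : Fin b → ℝ≥0∞} {ν : Measure ℝ}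

lemma measure_one_eq_zero (hν : IsSelfSimilar b p ν) (hlast : p (Fin.rev 0) < 1) : ν {1} = 0 := by
  have := hν.isProbabilityMeasure
  have hb : 1 ≤ b := NeZero.one_le
  have hpreimage (j : Fin b) : (fun x : ℝ => (x + (j : ℕ)) / b) ⁻¹' {1} = {(b : ℝ) - (j : ℕ)} := by
    ext x
    rw [mem_preimage, mem_singleton_iff, mem_singleton_iff,
      div_eq_one_iff_eq (by exact_mod_cast NeZero.ne b), eq_sub_iff_add_eq]
  have hother : ∀ j : Fin b, j ≠ Fin.rev 0 → ν {(b : ℝ) - (j : ℕ)} = 0 := by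
    intro j hj
    have hout : (b : ℝ) - (j : ℕ) ∉ Icc (0 : ℝ) 1 := by
      rintro ⟨-, h⟩
      rw [sub_le_iff_le_add'] at h
      have hle : b ≤ (j : ℕ) + 1 := by exact_mod_cast h
      refine hj (Fin.ext ?_)
      rw [Fin.val_rev, Fin.coe_ofNat_eq_mod, Nat.zero_mod]
      lia
    exact measure_mono_null (singleton_subset_iff.2 hout) hν.compl_Icc
  have hfixed : ν {1} = p (Fin.rev 0) * ν {1} := by
    conv_lhs => rw [hν.apply_eq_sum _ (measurableSet_singleton 1), Finset.sum_eq_single (Fin.rev 0)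
      (fun j _ hj => by rw [hpreimage, hother j hj, mul_zero]) (by simp), hpreimage]
    rw [Fin.val_rev, Fin.coe_ofNat_eq_mod, Nat.zero_mod, zero_add, Nat.cast_sub hb,
      sub_sub_cancel, Nat.cast_one]
  by_contra hpos
  exact hfixed.not_gt
    (by simpa using ENNReal.mul_lt_mul_left hpos (measure_ne_top ν {1}) hlast)

lemma measure_unit_cell (hν : IsSelfSimilar b p ν) (hlast : p (Fin.rev 0) < 1) (k : ℤ) :
    ν (cell b 0 k) = if k = 0 then 1 else 0 := by
  have := hν.isProbabilityMeasure
  have hcompl : ν (cell b 0 0)ᶜ = 0 := by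
    refine measure_mono_null (fun x hx => ?_)
      (measure_union_null hν.compl_Icc (hν.measure_one_eq_zero hlast))
    simp only [cell, mem_compl_iff, mem_Ico, mem_union, mem_Icc, mem_singleton_iff, zpow_zero,
      Int.cast_zero, zero_mul, zero_add, one_mul] at hx ⊢
    grind
  split_ifs with hk
  · rw [hk, ← prob_compl_eq_zero_iff measurableSet_cell, hcompl]
  · refine measure_mono_null (fun x hx => (fun h0 : x ∈ cell b 0 0 => hk ?_)) hcompl
    rw [← mem_cell_iff_floor.1 hx, mem_cell_iff_floor.1 h0]

lemma measure_cell_succ_eq_sum (hν : IsSelfSimilar b p ν) (n : ℕ) (k : ℤ) :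
    ν (cell b (-(n + 1)) k) = ∑ i : Fin b, p i * ν (cell b (-n) (k - (i : ℕ) * b ^ n)) := by
  rw [hν.apply_eq_sum _ measurableSet_cell]
  simp only [preimage_add_div_cell]

lemma child (hν : IsSelfSimilar b p ν) (hlast : p (Fin.rev 0) < 1) (n : ℕ) (k : ℤ) (j : Fin b) :
    ν (cell b (-(n + 1)) (b * k + (j : ℕ))) = p j * ν (cell b (-n) k) := by
  induction n generalizing k with
  | zero =>
    have hb : b ≠ 0 := NeZero.ne b
    rw [hν.measure_cell_succ_eq_sum, Finset.sum_eq_single j]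
    · simp [hν.measure_unit_cell hlast, hb]
    · intro i _ hij
      have hne : (b : ℤ) * k + (j : ℕ) - (i : ℕ) * b ^ 0 ≠ 0 := by
        intro h
        rw [pow_zero, mul_one, sub_eq_zero] at h
        have hk : k = 0 := by
          rw [← mul_add_fin_ediv k j, h, ← mul_add_fin_ediv 0 i, mul_zero, zero_add]
        exact hij (Fin.ext (by simpa [hk] using h.symm))
      rw [Nat.cast_zero, neg_zero, hν.measure_unit_cell hlast, if_neg hne, mul_zero]
    · simp
  | succ n ih =>
    have hindex (i : Fin b) : b * k + (j : ℕ) - (i : ℕ) * (b : ℤ) ^ (n + 1) =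
        b * (k - (i : ℕ) * b ^ n) + (j : ℕ) := by
      ring
    have hexpand := hν.measure_cell_succ_eq_sum (n + 1) (b * k + (j : ℕ))
    simp only [Nat.cast_succ, hindex, ih] at hexpand
    rw [Nat.cast_succ, hexpand, hν.measure_cell_succ_eq_sum, Finset.mul_sum]
    exact Finset.sum_congr rfl fun i _ => mul_left_comm _ _ _

end IsSelfSimilar

/-- The sum of all integer translates of `ν`. -/
def periodization (ν : Measure ℝ) : Measure ℝ := Measure.sum fun l : ℤ => ν.map fun x => x + (l : ℝ)

lemma map_add_one_periodization (ν : Measure ℝ) :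
    (periodization ν).map (fun x => x + 1) = periodization ν := by
  have hadd (c : ℝ) : Measurable fun x : ℝ => x + c := by fun_prop
  have hshift : (fun l : ℤ => (ν.map fun x => x + (l : ℝ)).map fun x => x + 1) =
      (fun l : ℤ => ν.map fun x => x + (l : ℝ)) ∘ Equiv.addRight (1 : ℤ) := by
    funext l
    rw [Measure.map_map (hadd 1) (hadd l)]
    simp [Function.comp_def, add_assoc]
  rw [periodization, Measure.map_sum (hadd 1).aemeasurable, hshift, Measure.sum_comp_equiv]

lemma periodization_cell {b : ℕ} [NeZero b] (ν : Measure ℝ) (n : ℕ) (k : ℤ) :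
    periodization ν (cell b (-n) k) = ∑' l : ℤ, ν (cell b (-n) (k - l * b ^ n)) := by
  rw [periodization, Measure.sum_apply _ measurableSet_cell]
  refine tsum_congr fun l => ?_
  rw [Measure.map_apply (by fun_prop) measurableSet_cell, preimage_add_cell]

lemma IsSelfSimilar.isMultinomial_periodization {b : ℕ} [NeZero b] {p : Fin b → ℝ≥0∞}
    {ν : Measure ℝ} (hν : IsSelfSimilar b p ν) (hlast : p (Fin.rev 0) < 1) :
    IsMultinomial b p (periodization ν) where
  periodic := map_add_one_periodization ν
  unit k := by
    have hcell := periodization_cell (b := b) ν 0 k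
    rw [Nat.cast_zero, neg_zero] at hcell
    simp [hcell, hν.measure_unit_cell hlast, sub_eq_zero]
  child n k j := by
    have hindex (l : ℤ) : b * k + (j : ℕ) - l * b ^ (n + 1) = b * (k - l * b ^ n) + (j : ℕ) := by
      ring
    rw [← Nat.cast_succ, periodization_cell, periodization_cell, ← ENNReal.tsum_mul_left]
    simp only [Nat.succ_eq_add_one, hindex, Nat.cast_succ, hν.child hlast]

theorem exists_isMultinomial {b : ℕ} [NeZero b] (p : Fin b → ℝ≥0∞) (hp : ∑ j, p j = 1)
    (hlast : p (Fin.rev 0) < 1) : ∃ μ, IsMultinomial b p μ :=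
  (exists_isSelfSimilar p hp).imp' periodization fun _ hν => hν.isMultinomial_periodization hlast

lemma triadic_ae_eq_cell {μ : Measure ℝ} [NullSingletonClass μ] (n : ℕ) (k : ℤ) :
    triadic n k =ᵐ[μ] cell 3 (-n) k := by
  rw [triadic, cell, zpow_neg, zpow_natCast, ← div_eq_mul_inv, ← div_eq_mul_inv]
  exact Ico_ae_eq_Icc.symm

/-- The weights `(1 - δ) / 2`, `δ`, `(1 - δ) / 2` of the triadic Garnett–Killip–Schul measure. -/
def gksWeight (δ : ℝ) : Fin 3 → ℝ≥0∞ :=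
  ![ENNReal.ofReal ((1 - δ) / 2), ENNReal.ofReal δ, ENNReal.ofReal ((1 - δ) / 2)]

lemma IsMultinomial.isGKS {δ : ℝ} {μ : Measure ℝ} [NullSingletonClass μ]
    (hμ : IsMultinomial 3 (gksWeight δ) μ) : IsGKS δ μ := by
  have hunit := triadic_ae_eq_cell (μ := μ) 0 0
  have hchild (n : ℕ) (k : ℤ) (j : Fin 3) :
      μ (triadic (n + 1) (3 * k + (j : ℕ))) = gksWeight δ j * μ (triadic n k) := by
    rw [measure_congr (triadic_ae_eq_cell _ _), measure_congr (triadic_ae_eq_cell _ _), ← hμ.child]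
    norm_cast
  refine ⟨?_, hμ.periodic, fun n k _ _ => ⟨?_, ?_, ?_⟩⟩
  · simpa [triadic, hμ.unit] using measure_congr hunit
  · simpa [gksWeight] using hchild n k 0
  · simpa [gksWeight] using hchild n k 1
  · simpa [gksWeight] using hchild n k 2

section Weights

variable {δ : ℝ}

lemma sum_gksWeight (hδ₀ : 0 ≤ δ) (hδ₁ : δ ≤ 1) : ∑ j, gksWeight δ j = 1 := by
  simp only [Fin.sum_univ_three, gksWeight, Matrix.cons_val]
  rw [← ENNReal.ofReal_add (by linarith) hδ₀, ← ENNReal.ofReal_add (by linarith) (by linarith),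
    ← ENNReal.ofReal_one]
  congr 1
  ring

lemma gksWeight_le (hδ : δ ≤ 1 / 3) (j : Fin 3) :
    gksWeight δ j ≤ ENNReal.ofReal ((1 - δ) / 2) := by
  have hle : ENNReal.ofReal δ ≤ ENNReal.ofReal ((1 - δ) / 2) :=
    ENNReal.ofReal_le_ofReal (by linarith)
  fin_cases j <;> simp [gksWeight, hle]

lemma gksWeight_ne_inv_three (hδ : δ < 1 / 3) (j : Fin 3) : gksWeight δ j ≠ 3⁻¹ := by
  have hthree : (3⁻¹ : ℝ≥0∞) = ENNReal.ofReal (1 / 3) := by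
    rw [one_div, ENNReal.ofReal_inv_of_pos three_pos, ENNReal.ofReal_ofNat]
  have hmiddle : ENNReal.ofReal δ < 3⁻¹ :=
    hthree ▸ (ENNReal.ofReal_lt_ofReal_iff (by norm_num)).2 hδ
  have houter : 3⁻¹ < ENNReal.ofReal ((1 - δ) / 2) :=
    hthree ▸ (ENNReal.ofReal_lt_ofReal_iff (by linarith)).2 (by linarith)
  fin_cases j <;> simp [gksWeight, hmiddle.ne, houter.ne']

lemma le_gksWeight (hδ : δ ≤ 1 / 3) (j : Fin 3) : ENNReal.ofReal δ ≤ gksWeight δ j := by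
  have hle : ENNReal.ofReal δ ≤ ENNReal.ofReal ((1 - δ) / 2) :=
    ENNReal.ofReal_le_ofReal (by linarith)
  fin_cases j <;> simp [gksWeight, hle]

lemma one_le_inv_mul_gksWeight (hδ₀ : 0 < δ) (hδ₁ : δ ≤ 1 / 3) (j : Fin 3) :
    1 ≤ (δ⁻¹.toNNReal : ℝ≥0∞) * gksWeight δ j := by
  calc 1 = ENNReal.ofReal δ⁻¹ * ENNReal.ofReal δ := by
        rw [← ENNReal.ofReal_mul (by positivity), inv_mul_cancel₀ hδ₀.ne', ENNReal.ofReal_one]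
    _ ≤ ENNReal.ofReal δ⁻¹ * gksWeight δ j := by
        gcongr
        exact le_gksWeight hδ₁ j

lemma gksWeight_lt_one (hδ₀ : 0 < δ) (hδ₁ : δ ≤ 1 / 3) (j : Fin 3) : gksWeight δ j < 1 :=
  (gksWeight_le hδ₁ j).trans_lt (ENNReal.ofReal_lt_one.2 (by linarith))

lemma IsMultinomial.hasMassDecay_of_gksWeight {μ : Measure ℝ}
    (hμ : IsMultinomial 3 (gksWeight δ) μ) (hδ₀ : 0 < δ) (hδ₁ : δ ≤ 1 / 3) :
    HasMassDecay (Real.log (2 / (1 - δ)) / Real.log 3) μ := by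
  have hgrid := hμ.isGridDoubling (one_le_inv_mul_gksWeight hδ₀ hδ₁) rfl
  simpa [Real.logb] using hgrid.hasMassDecay (by norm_num) (by linarith) (by linarith)
    (hμ.child_le (gksWeight_le hδ₁))

end Weights

lemma IsAInfty.absolutelyContinuous {ω : Measure ℝ} (hω : IsAInfty ω) : ω ≪ volume := by
  obtain ⟨p, -, -, w, -, rfl, -⟩ := hω
  exact withDensity_absolutelyContinuous _ _

lemma AInftyInequality.absolutelyContinuous {ω : Measure ℝ} (hω : AInftyInequality ω) :
    ω ≪ volume := by
  obtain ⟨C, ε, hε, hω⟩ := hω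
  refine Measure.AbsolutelyContinuous.mk fun s hs hs₀ => ?_
  have hcover : s ⊆ ⋃ n : ℕ, s ∩ Icc (-(n + 1 : ℝ)) (n + 1) := fun x hx => by
    obtain ⟨n, hn⟩ := exists_nat_ge |x|
    rw [abs_le] at hn
    exact mem_iUnion.2 ⟨n, hx, by linarith, by linarith⟩
  refine measure_mono_null hcover (measure_iUnion_null fun n => ?_)
  have hle := hω (-(n + 1)) (n + 1) (by linarith [n.cast_nonneg (α := ℝ)]) _
    (hs.inter measurableSet_Icc) inter_subset_right
  rwa [measure_mono_null inter_subset_left hs₀, ENNReal.zero_div, ENNReal.zero_rpow_of_pos hε,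
    mul_zero, zero_mul, nonpos_iff_eq_zero] at hle

end FracAInf

end

theorem mainTheorem9 (δ : ℝ) (hδ₀ : 0 < δ) (hδ₁ : δ < 1 / 3) :
    ∃ μ : Measure ℝ,
      FracAInf.IsGKS δ μ ∧
      IsLocallyFiniteMeasure μ ∧
      μ ⟂ₘ volume ∧
      FracAInf.IsDoubling μ ∧
      (∃ α₀ ∈ Ioo (0 : ℝ) 1, ∀ α ∈ Ioo α₀ 1,
        FracAInf.IsFracAInftyWith α (fun t => t) μ) ∧
      (∀ α ∈ Ioo (1 - Real.log (2 / (1 - δ)) / Real.log 3) 1,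
        ∃ C : ℝ≥0, FracAInf.IsFracAInftyWith α (fun t => min (C * t) 1) μ) ∧
      ¬ FracAInf.IsAInfty μ ∧
      ¬ FracAInf.AInftyInequality μ := by
  obtain ⟨μ, hμ⟩ := FracAInf.exists_isMultinomial (FracAInf.gksWeight δ)
    (FracAInf.sum_gksWeight hδ₀.le (by linarith)) (FracAInf.gksWeight_lt_one hδ₀ hδ₁.le _)
  have hgrid := hμ.isGridDoubling (FracAInf.one_le_inv_mul_gksWeight hδ₀ hδ₁.le) rfl
  have hdoubling := hgrid.isDoubling (by norm_num) hμ.ne_zero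
  have : IsLocallyFiniteMeasure μ := hgrid.isLocallyFiniteMeasure (m := 0) (by simp [hμ.unit])
  have hdecay := hμ.hasMassDecay_of_gksWeight hδ₀ hδ₁.le
  have : NullSingletonClass μ := hdecay.nullSingletonClass <| div_pos
    (Real.log_pos <| (one_lt_div (by linarith)).2 (by linarith)) (Real.log_pos (by norm_num))
  have hsingular := hμ.mutuallySingular (by norm_num) (FracAInf.gksWeight_ne_inv_three hδ₁)
  have hnot_ac : ¬ μ ≪ volume := fun hac =>
    hμ.ne_zero (Measure.eq_zero_of_absolutelyContinuous_of_mutuallySingular hac hsingular)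
  refine ⟨μ, hμ.isGKS, inferInstance, hsingular, hdoubling, ?_, fun α hα => ?_,
    fun h => hnot_ac h.absolutelyContinuous, fun h => hnot_ac h.absolutelyContinuous⟩
  · obtain ⟨α₀, ⟨hα₀, hα₀'⟩, hsub⟩ := (mem_nhdsLT_iff_exists_mem_Ico_Ioo_subset
      one_half_lt_one).1 hdoubling.eventually_isFracAInftyWith_id
    exact ⟨α₀, ⟨one_half_pos.trans_le hα₀, hα₀'⟩, hsub⟩
  · obtain ⟨D, hD, hriesz⟩ := hdecay.exists_rieszBound hα.1 hα.2
    exact ⟨D, hriesz.isFracAInftyWith_min hD⟩
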